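/- A chord diagram of degree $k\ge 0$ is an oriented circle with $k$ chords whose $2k$ endpoints are distinct, determined by the cyclic order of the endpoints. More generally, consider diagrams $D$ of finitely many unmarked chords attached to a non-empty finite disjoint union of circles, each circle carrying an orientation near each chord endpoint on it (these local orientations need not agree along a circle). For a chord $v$ of $D$ let $D_v$ (resp. $D^v$) be obtained by surgery on $v$: replace $v$ by an untwisted (resp. half-twisted) band and remove the interior of the band and the intervals where it is attached. Thus, in $D_v$, the side of each endpoint of $v$ on which one arrives is joined to the side of the other endpoint on which one leaves; in $D^v$ the two arriving sides are joined, and the two leaving sides are joined. Let $O$ be the circle without chords. The framed Kauffman regular weight system $K$ is the function on these diagrams with values in $\mathbb{Z}[a,b]$ such that, for every diagram $D$ and every chord $v$ of $D$, $$K(D)=a\bigl(K(D_v)-K(D^v)\bigr),\qquad K(D\cup O)=b\,K(D),\qquad K(O)=1 .$$ For a finite simple graph $G$ and $J\subseteq V(G)$, let $\mathrm{rank}(G^J)$ be the rank over $\mathbb{Z}_2$ of the adjacency matrix of $G$ modified to have diagonal entry $1$ at the vertices in $J$ (the marked vertices), and let $$S(G)(x)=\sum_{J\subseteq V(G)}(-1)^{|J|}x^{\mathrm{rank}(G^J)}\in\mathbb{Z}[x].$$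 Let $\Gamma(D)$ be the intersection graph of a chord diagram $D$: its vertices are the chords, and two chords are adjacent when their endpoints alternate on the circle. Let $A_k$ be the abelian group generated by the chord diagrams of degree $k$ modulo the 4-term relations. Theorem. There is exactly one function $K$ as above. For every chord diagram $D$ of degree $k$, $$K(D)=(ab)^k\,S(\Gamma(D))(b^{-1})\qquad\text{in } \mathbb{Q}(a,b).$$ Moreover $D\mapsto K(D)$ and $D\mapsto S(\Gamma(D))$ induce linear maps on $A_k$, and the same formula holds for every $D\in A_k$. -/

import Mathlib

/-! Chord diagrams -/

/-- The `2 n` endpoints of `n` labelled chords: `(c, false)` and `(c, true)` are the two endpoints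
of the chord `c`. -/
abbrev Endpoint (n : ℕ) : Type := Fin n × Bool

/-- A chord diagram of degree `n`, with labelled chords: the order in which the `2 n` endpoints are
met when one travels once along the oriented circle, starting at some point of the circle that is
not an endpoint. The choices of the starting point and of the labels are divided out in
`ChordDiagram.Equivalent`. -/
structure ChordDiagram (n : ℕ) where
  pos : Endpoint n ≃ Fin (2 * n)

namespace ChordDiagram

/-- The cyclic order of the endpoints: `D.succ p` is the endpoint that follows `p` on the oriented
circle. -/
def succ {n : ℕ} (D : ChordDiagram n) : Equiv.Perm (Endpoint n) :=
  (D.pos.trans (finRotate (2 * n))).trans D.pos.symm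

/-- Two diagrams are the same up to an orientation-preserving homeomorphism of circles that maps
chords to chords: a bijection of the endpoints that respects the chords and the cyclic orders. -/
def Equivalent {n : ℕ} (D D' : ChordDiagram n) : Prop :=
  ∃ e : Equiv.Perm (Endpoint n),
    (∀ p q : Endpoint n, p.1 = q.1 ↔ (e p).1 = (e q).1) ∧ ∀ p, e (D.succ p) = D'.succ (e p)

/-- The diagrams of a four-term relation `D₁ - D₂ + D₃ - D₄ = 0`. They differ only in the place of
the endpoint `x` of one chord, which stands immediately before (`D₁`) or after (`D₂`) one endpoint
`p` of another chord, or immediately before (`D₃`) or after (`D₄`) the other endpoint `q` of that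
chord. The permutation `s` is the common cyclic order of all the endpoints but `x`;
`swap p x * s` inserts `x` into it just before `p`, and `s * swap p x` just after `p`. -/
def IsFourTerm {n : ℕ} (D₁ D₂ D₃ D₄ : ChordDiagram n) : Prop :=
  ∃ (s : Equiv.Perm (Endpoint n)) (x p q : Endpoint n),
    s x = x ∧ p ≠ q ∧ p.1 = q.1 ∧ p.1 ≠ x.1 ∧
    D₁.succ = Equiv.swap p x * s ∧ D₂.succ = s * Equiv.swap p x ∧
    D₃.succ = Equiv.swap q x * s ∧ D₄.succ = s * Equiv.swap q x

/-- The relations that define `ChordSpace n`. -/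
noncomputable def relations (n : ℕ) : Submodule ℤ (ChordDiagram n →₀ ℤ) :=
  Submodule.span ℤ
    ({r | ∃ D D' : ChordDiagram n, D.Equivalent D' ∧
        r = Finsupp.single D 1 - Finsupp.single D' 1} ∪
     {r | ∃ D₁ D₂ D₃ D₄ : ChordDiagram n, IsFourTerm D₁ D₂ D₃ D₄ ∧
        r = Finsupp.single D₁ 1 - Finsupp.single D₂ 1 +
          Finsupp.single D₃ 1 - Finsupp.single D₄ 1})

/-- The endpoints of the chords `i` and `j` alternate, starting with one of `i`. -/
def AlternateFrom {n : ℕ} (D : ChordDiagram n) (i j : Fin n) : Prop :=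
  ∃ β γ : Bool, D.pos (i, β) < D.pos (j, γ) ∧ D.pos (j, γ) < D.pos (i, !β) ∧
    D.pos (i, !β) < D.pos (j, !γ)

/-- The intersection graph: one vertex for each chord, and an edge between two chords when their
endpoints alternate on the circle. -/
def intersectionGraph {n : ℕ} (D : ChordDiagram n) : SimpleGraph (Fin n) where
  Adj i j := D.AlternateFrom i j ∨ D.AlternateFrom j i
  symm := ⟨fun _ _ h => h.symm⟩
  loopless := ⟨fun i h => by
    have key : ¬ D.AlternateFrom i i := by
      rintro ⟨β, γ, h1, h2, -⟩
      cases β <;> cases γ <;> simp_all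
    exact h.elim key key⟩

end ChordDiagram

/-- The group of chord diagrams of degree `n` modulo the four-term relations. -/
abbrev ChordSpace (n : ℕ) : Type := (ChordDiagram n →₀ ℤ) ⧸ ChordDiagram.relations n

/-- The class of a chord diagram. -/
noncomputable def ChordSpace.mk {n : ℕ} (D : ChordDiagram n) : ChordSpace n :=
  (ChordDiagram.relations n).mkQ (Finsupp.single D 1)

/-! The polynomial `S` of a graph -/

open Classical in
/-- The adjacency matrix over `ℤ/2` of the marked graph obtained from `G` by marking the vertices
in `J`: marked vertices get a `1` on the diagonal. -/
noncomputable def markedAdjMatrix {V : Type*} (G : SimpleGraph V) (J : Finset V) :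
    Matrix V V (ZMod 2) :=
  Matrix.of fun u v => if G.Adj u v ∨ (u = v ∧ u ∈ J) then 1 else 0

/-- `S(G) = ∑_J (-1)^|J| x^rank(G^J)`, over all sets `J` of vertices. -/
noncomputable def graphS {V : Type*} [Fintype V] (G : SimpleGraph V) : Polynomial ℤ :=
  ∑ J : Finset V, (-1) ^ J.card * Polynomial.X ^ (markedAdjMatrix G J).rank

/-! Chord diagrams on several circles, and surgery -/

/-- The two sides of the endpoints: `(p, false)` is the side on which one arrives at `p`, and
`(p, true)` the side on which one leaves `p`, in the orientation of the circle near `p`. -/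
abbrev EndSide (n : ℕ) : Type := Endpoint n × Bool

/-- A diagram of `n` labelled chords on a non-empty disjoint union of circles, where each circle
carries an orientation near each endpoint of a chord on it; these local orientations need not agree
along a circle (a surgery with a half-twisted band creates such circles). The endpoints cut their
circles into arcs: `arc` sends each side of an endpoint to the other end of the arc that starts
there. `circles` counts the circles without endpoints. -/
structure BandDiagram (n : ℕ) where
  arc : Equiv.Perm (EndSide n)
  arc_arc : ∀ f, arc (arc f) = f
  arc_ne : ∀ f, arc f ≠ f
  circles : ℕ
  nonempty : 0 < n ∨ 0 < circles

/-- Joining the sides `x` and `y`, whose other arc ends are `u` and `w`: the new pairing joins `u`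
with `w`, and (as a discarded remainder) `x` with `y`. If `x` and `y` are the two ends of one arc,
this arc closes up to a circle, and the pairing stays the same. -/
def glue {X : Type*} [DecidableEq X] (α : Equiv.Perm X) (x y : X) : Equiv.Perm X :=
  Equiv.swap (α x) y * α * Equiv.swap (α x) y

theorem glue_glue {X : Type*} [DecidableEq X] {α : Equiv.Perm X} (h : ∀ z, α (α z) = z)
    (x y z : X) : glue α x y (glue α x y z) = z := by
  simp [glue, h]

theorem glue_ne {X : Type*} [DecidableEq X] {α : Equiv.Perm X} (h : ∀ z, α z ≠ z)
    (x y z : X) : glue α x y z ≠ z := by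
  intro e
  have e' : α (Equiv.swap (α x) y z) = Equiv.swap (α x) y z := by
    have := congrArg (Equiv.swap (α x) y) e
    simpa [glue] using this
  exact h _ e'

theorem glue_left {X : Type*} [DecidableEq X] {α : Equiv.Perm X} (h : ∀ z, α z ≠ z)
    {x y : X} (hxy : x ≠ y) : glue α x y x = y := by
  simp [glue, Equiv.swap_apply_of_ne_of_ne (h x).symm hxy]

theorem glue_right {X : Type*} [DecidableEq X] {α : Equiv.Perm X} (h2 : ∀ z, α (α z) = z)
    (h : ∀ z, α z ≠ z) {x y : X} (hxy : x ≠ y) : glue α x y y = x := by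
  have := glue_glue h2 x y x
  rwa [glue_left h hxy] at this

theorem glue_of_pair {X : Type*} [DecidableEq X] {α : Equiv.Perm X} (h2 : ∀ z, α (α z) = z)
    (x y : X) {z w : X} (hzw : α z = w) (hzx : z ≠ x) (hzy : z ≠ y) (hwx : w ≠ x) (hwy : w ≠ y) :
    glue α x y z = w := by
  have h1 : z ≠ α x := fun e => hwx (by rw [← hzw, e, h2])
  have h3 : w ≠ α x := fun e => hzx (α.injective (hzw.trans e))
  simp [glue, Equiv.swap_apply_of_ne_of_ne h1 hzy, hzw, Equiv.swap_apply_of_ne_of_ne h3 hwy]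

namespace BandDiagram

/-- The circle without chords. -/
def unknot : BandDiagram 0 where
  arc := Equiv.refl _
  arc_arc _ := rfl
  arc_ne f := f.1.1.elim0
  circles := 1
  nonempty := Or.inr Nat.one_pos

/-- The disjoint union with a circle. -/
def addCircle {n : ℕ} (D : BandDiagram n) : BandDiagram n :=
  { D with circles := D.circles + 1, nonempty := Or.inr (Nat.succ_pos _) }

/-- The side of the endpoint `(v, true)` that the side `δ` of the endpoint `(v, false)` is joined to
along an edge of the band that replaces the chord `v`. The untwisted band (`t = false`) joins
arriving sides to leaving sides; the half-twisted band (`t = true`) joins the two arriving sides,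
and the two leaving sides. -/
def partner {n : ℕ} (v : Fin n) (t δ : Bool) : EndSide n := ((v, true), if t then δ else !δ)

/-- The pairing of the sides after the surgery on `v`. -/
def surgeryAux {n : ℕ} (D : BandDiagram n) (v : Fin n) (t : Bool) : Equiv.Perm (EndSide n) :=
  glue (glue D.arc ((v, false), false) (partner v t false)) ((v, false), true) (partner v t true)

/-- The number of circles without endpoints that close up in the surgery on `v`. -/
def newCircles {n : ℕ} (D : BandDiagram n) (v : Fin n) (t : Bool) : ℕ :=
  (if D.arc ((v, false), false) = partner v t false then 1 else 0) +
  (if glue D.arc ((v, false), false) (partner v t false) ((v, false), true) = partner v t true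
    then 1 else 0)

theorem surgeryAux_surgeryAux {n : ℕ} (D : BandDiagram n) (v : Fin n) (t : Bool) (f : EndSide n) :
    D.surgeryAux v t (D.surgeryAux v t f) = f :=
  glue_glue (glue_glue D.arc_arc _ _) _ _ _

theorem surgeryAux_mem {n : ℕ} (D : BandDiagram n) (v : Fin n) (t : Bool) (f : EndSide n)
    (hf : f.1.1 = v) : (D.surgeryAux v t f).1.1 = v := by
  have h2 := glue_glue D.arc_arc ((v, false), false) (partner v t false)
  have h1 := glue_ne D.arc_ne ((v, false), false) (partner v t false)
  have a1 := glue_left D.arc_ne (x := ((v, false), false)) (y := partner v t false)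
    (by simp [partner])
  have a2 := glue_right D.arc_arc D.arc_ne (x := ((v, false), false)) (y := partner v t false)
    (by simp [partner])
  have b1 : D.surgeryAux v t ((v, false), true) = partner v t true :=
    glue_left h1 (by simp [partner])
  have b2 : D.surgeryAux v t (partner v t true) = ((v, false), true) :=
    glue_right h2 h1 (by simp [partner])
  have b3 : D.surgeryAux v t ((v, false), false) = partner v t false :=
    glue_of_pair h2 _ _ a1 (by simp) (by simp [partner]) (by simp [partner])
      (by cases t <;> simp [partner])
  have b4 : D.surgeryAux v t (partner v t false) = ((v, false), false) :=
    glue_of_pair h2 _ _ a2 (by simp [partner]) (by cases t <;> simp [partner]) (by simp)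
      (by simp [partner])
  obtain ⟨⟨c, β⟩, δ⟩ := f
  obtain rfl : c = v := hf
  cases t <;> cases β <;> cases δ <;> simp [partner] at b1 b2 b3 b4 ⊢ <;> simp [*]

theorem surgeryAux_mem_iff {n : ℕ} (D : BandDiagram n) (v : Fin n) (t : Bool) (f : EndSide n) :
    (D.surgeryAux v t f).1.1 ≠ v ↔ f.1.1 ≠ v := by
  refine not_congr ⟨fun h => ?_, D.surgeryAux_mem v t f⟩
  have := D.surgeryAux_mem v t _ h
  rwa [surgeryAux_surgeryAux] at this

/-- The sides of the endpoints of the chords other than `v`, with these chords relabelled in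
order. -/
def sideEquiv {n : ℕ} (v : Fin (n + 1)) : EndSide n ≃ {f : EndSide (n + 1) // f.1.1 ≠ v} where
  toFun f := ⟨((v.succAbove f.1.1, f.1.2), f.2), Fin.succAbove_ne v _⟩
  invFun f := (((finSuccAboveEquiv v).symm ⟨f.1.1.1, f.2⟩, f.1.1.2), f.1.2)
  left_inv f := by
    have : (finSuccAboveEquiv v).symm ⟨v.succAbove f.1.1, Fin.succAbove_ne v _⟩ = f.1.1 := by
      rw [Equiv.symm_apply_eq]; rfl
    ext <;> simp [this]
  right_inv f := by
    have : v.succAbove ((finSuccAboveEquiv v).symm ⟨f.1.1.1, f.2⟩) = f.1.1.1 :=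
      congrArg Subtype.val ((finSuccAboveEquiv v).apply_symm_apply ⟨f.1.1.1, f.2⟩)
    apply Subtype.ext
    ext <;> simp [this]

theorem newCircles_pos (D : BandDiagram 1) (v : Fin 1) (t : Bool) : 0 < D.newCircles v t := by
  by_contra hc
  have h2 := glue_glue D.arc_arc ((v, false), false) (partner v t false)
  have h1 := glue_ne D.arc_ne ((v, false), false) (partner v t false)
  have a1 := glue_left D.arc_ne (x := ((v, false), false)) (y := partner v t false)
    (by simp [partner])
  have a2 := glue_right D.arc_arc D.arc_ne (x := ((v, false), false)) (y := partner v t false)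
    (by simp [partner])
  have hne : glue D.arc ((v, false), false) (partner v t false) ((v, false), true)
      ≠ partner v t true := by
    intro e
    simp [newCircles, e] at hc
  have i1 : glue D.arc ((v, false), false) (partner v t false) ((v, false), true)
      ≠ ((v, false), true) := h1 _
  have i2 : glue D.arc ((v, false), false) (partner v t false) ((v, false), true)
      ≠ partner v t false := by
    intro e
    have := Equiv.injective _ (e.trans a1.symm)
    simp at this
  have i3 : glue D.arc ((v, false), false) (partner v t false) ((v, false), true)
      ≠ ((v, false), false) := by
    intro e
    have := Equiv.injective _ (e.trans a2.symm)
    cases t <;> simp [partner] at this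
  generalize glue D.arc ((v, false), false) (partner v t false) ((v, false), true) = g at *
  obtain ⟨⟨c, β⟩, δ⟩ := g
  obtain rfl : c = v := Subsingleton.elim _ _
  cases t <;> cases β <;> cases δ <;> simp [partner] at hne i1 i2 i3

/-- Surgery: the chord `v` is replaced by a band, untwisted for `t = false` and half-twisted for
`t = true`, and the interior of the band and the intervals where it is attached are removed. -/
def surgery {n : ℕ} (D : BandDiagram (n + 1)) (v : Fin (n + 1)) (t : Bool) : BandDiagram n where
  arc := (sideEquiv v).trans
    (((D.surgeryAux v t).subtypePerm (D.surgeryAux_mem_iff v t)).trans (sideEquiv v).symm)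
  arc_arc f := by
    simp [Equiv.Perm.subtypePerm_apply, surgeryAux_surgeryAux]
  arc_ne f := by
    intro e
    have e' := (sideEquiv v).symm_apply_eq.1 e
    have e'' := congrArg Subtype.val e'
    exact glue_ne (glue_ne D.arc_ne _ _) _ _ _ e''
  circles := D.circles + D.newCircles v t
  nonempty := by
    rcases Nat.eq_zero_or_pos n with rfl | h
    · exact Or.inr (Nat.add_pos_right _ (D.newCircles_pos v t))
    · exact Or.inl h

end BandDiagram

/-- A chord diagram, as a diagram on one circle. -/
def ChordDiagram.toBand {n : ℕ} (D : ChordDiagram n) : BandDiagram n where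
  arc :=
    { toFun := fun f => if f.2 then (D.succ f.1, false) else (D.succ.symm f.1, true)
      invFun := fun f => if f.2 then (D.succ f.1, false) else (D.succ.symm f.1, true)
      left_inv := by rintro ⟨p, δ⟩; cases δ <;> simp
      right_inv := by rintro ⟨p, δ⟩; cases δ <;> simp }
  arc_arc := by rintro ⟨p, δ⟩; cases δ <;> simp
  arc_ne := by rintro ⟨p, δ⟩; cases δ <;> simp
  circles := if n = 0 then 1 else 0
  nonempty := by by_cases h : n = 0 <;> simp [h, Nat.pos_iff_ne_zero]

/-! The Kauffman weight system -/

/-- The ring `ℤ[a, b]`. -/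
abbrev ZAB : Type := MvPolynomial (Fin 2) ℤ

/-- The variable `a`. -/
noncomputable def varA : ZAB := MvPolynomial.X 0

/-- The variable `b`. -/
noncomputable def varB : ZAB := MvPolynomial.X 1

/-- The skein relations that define the framed Kauffman weight system:
`K(D) = a (K(D_v) - K(D^v))` for every chord `v`, where `v` is replaced by an untwisted band in
`D_v` and by a half-twisted band in `D^v`; `K(D ∪ O) = b K(D)`; and `K(O) = 1`. -/
structure IsKauffmanWeight (K : (n : ℕ) → BandDiagram n → ZAB) : Prop where
  skein : ∀ (n : ℕ) (D : BandDiagram (n + 1)) (v : Fin (n + 1)),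
    K (n + 1) D = varA * (K n (D.surgery v false) - K n (D.surgery v true))
  circle : ∀ (n : ℕ) (D : BandDiagram n), K n D.addCircle = varB * K n D
  unknot : K 0 BandDiagram.unknot = 1

/-- The inclusion of `ℤ[a, b]` into its field of fractions `ℚ(a, b)`. -/
noncomputable def toFrac : ZAB →+* FractionRing ZAB := algebraMap ZAB (FractionRing ZAB)

/-! Replacing every chord by an untwisted or a half-twisted band reduces the skein relations to
the state sum `BandDiagram.stateSum`: the value on a diagram of degree `n` is
`a ^ n * ∑ T, ± b ^ (c T - 1)`, where `c T` is the number of circles that the state `T` leaves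
(`BandDiagram.stateCircles`) and each half-twisted band contributes a sign. So there is at most one
weight system. The state sum is one because `c T` does not depend on which chord is treated first
(`BandDiagram.stateCircles_surgery`).

The circles of a state are the orbits on the sides of the endpoints under two involutions: along the
arcs and along the edges of the bands. They are counted here by the dimension over `ℤ/2` of the
space of functions invariant under both, which turns all arguments on circles into linear algebra:
* joining two sides splits off one orbit (`finrank_pairInvariants_glue`), which gives the
  independence of the order of surgeries;
* on a chord diagram, an invariant function jumps by the same amount `z v` at both endpoints of each
  chord `v`, is determined by `z` and its value at the starting point, and is invariant exactly when
  `z` is in the kernel of the marked adjacency matrix of the intersection graph. So the number of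
  circles is the corank plus one (`ChordDiagram.stateCircles_toBand`), which is the formula for `K`;
* an endpoint of a chord can slide along an edge of the band of another chord
  (`finrank_pairInvariants_slide`). Summed over the states with alternating signs, the slides
  cancel the four diagrams of a four-term relation (`ChordDiagram.IsFourTerm.stateTransform_eq`).
  This holds with any function of `c T` in place of the powers of `b`, so it covers `S` as well. -/

/-! ### Functions invariant under two involutions -/

/-- The functions with values in `ℤ/2` that are invariant under `σ` and under `τ`. The dimension
of this space is the number of orbits of `σ` and `τ`; when these are the two pairings of the sides
of endpoints, along the arcs and along the bands, the orbits are the circles that result. -/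
def pairInvariants {X : Type*} (σ τ : X → X) : Submodule (ZMod 2) (X → ZMod 2) where
  carrier := {f | (∀ x, f (σ x) = f x) ∧ ∀ x, f (τ x) = f x}
  add_mem' := fun hf hg => ⟨fun x => by simp [hf.1, hg.1], fun x => by simp [hf.2, hg.2]⟩
  zero_mem' := ⟨fun _ => rfl, fun _ => rfl⟩
  smul_mem' := fun c f hf => ⟨fun x => by simp [hf.1], fun x => by simp [hf.2]⟩

theorem mem_pairInvariants {X : Type*} {σ τ : X → X} {f : X → ZMod 2} :
    f ∈ pairInvariants σ τ ↔ (∀ x, f (σ x) = f x) ∧ ∀ x, f (τ x) = f x := Iff.rfl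

theorem finrank_pairInvariants_pos {X : Type*} [Finite X] [Nonempty X] (σ τ : X → X) :
    0 < Module.finrank (ZMod 2) (pairInvariants σ τ) := by
  refine Module.finrank_pos_iff_exists_ne_zero.2
    ⟨⟨fun _ => 1, fun _ => rfl, fun _ => rfl⟩, fun h => ?_⟩
  obtain ⟨x⟩ := ‹Nonempty X›
  exact one_ne_zero (congrFun (congrArg Subtype.val h) x)

/-- Invariants of two pairs of maps correspond when pulling back along `m` and `m'` exchanges
them. -/
theorem finrank_pairInvariants_congr {X Y : Type*} {σ τ : X → X} {σ' τ' : Y → Y}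
    (m : Y → X) (m' : X → Y)
    (h : ∀ f ∈ pairInvariants σ τ, f ∘ m ∈ pairInvariants σ' τ' ∧ (f ∘ m) ∘ m' = f)
    (h' : ∀ f ∈ pairInvariants σ' τ', f ∘ m' ∈ pairInvariants σ τ ∧ (f ∘ m') ∘ m = f) :
    Module.finrank (ZMod 2) (pairInvariants σ τ) =
      Module.finrank (ZMod 2) (pairInvariants σ' τ') :=
  LinearEquiv.finrank_eq
    { toFun := fun f => ⟨f.1 ∘ m, (h f.1 f.2).1⟩
      invFun := fun f => ⟨f.1 ∘ m', (h' f.1 f.2).1⟩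
      map_add' := fun _ _ => rfl
      map_smul' := fun _ _ => rfl
      left_inv := fun f => Subtype.ext (h f.1 f.2).2
      right_inv := fun f => Subtype.ext (h' f.1 f.2).2 }

theorem mem_pairInvariants_glue {X : Type*} [DecidableEq X] {α : Equiv.Perm X} {β : X → X}
    {x y : X} {f : X → ZMod 2} (hf : f (α x) = f y) :
    f ∈ pairInvariants (glue α x y) β ↔ f ∈ pairInvariants α β := by
  have hs : ∀ z, f (Equiv.swap (α x) y z) = f z := by
    intro z
    rw [Equiv.swap_apply_def]
    split_ifs with h1 h2
    · rw [h1, hf]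
    · rw [h2, hf]
    · rfl
  refine and_congr_left fun _ => ⟨fun h z => ?_, fun h z => ?_⟩
  · have := h (Equiv.swap (α x) y z)
    simpa [glue, hs] using this
  · simp [glue, hs, h]

/-- Joining the sides `x` and `y` splits the pair `{x, y}` off as an orbit of its own, unless it
already was one. -/
theorem finrank_pairInvariants_glue {X : Type*} [Finite X] [DecidableEq X] {α : Equiv.Perm X}
    {β : X → X} (h2 : ∀ z, α (α z) = z) (h : ∀ z, α z ≠ z) (hβ : ∀ z, β (β z) = z)
    {x y : X} (hxy : x ≠ y) (hx : β x = y) :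
    Module.finrank (ZMod 2) (pairInvariants (glue α x y) β) + (if α x = y then 1 else 0) =
      Module.finrank (ZMod 2) (pairInvariants α β) + 1 := by
  by_cases hy : α x = y
  · have : glue α x y = α := by
      rw [glue, hy, Equiv.swap_self]
      rfl
    rw [this, if_pos hy]
  have hinv : ∀ f ∈ pairInvariants α β, f (α x) = f y := fun f hf => by rw [hf.1, ← hx, hf.2]
  -- The invariants of `α` are cut out by one equation, which the indicator of `{x, y}` violates.
  let l : pairInvariants (glue α x y) β →ₗ[ZMod 2] ZMod 2 :=
    { toFun := fun f => f.1 (α x) - f.1 y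
      map_add' := fun f g => by simp; ring
      map_smul' := fun c f => by simp; ring }
  have hmem : (fun z => if z = x ∨ z = y then (1 : ZMod 2) else 0) ∈
      pairInvariants (glue α x y) β := by
    have gl := glue_left h hxy
    have gr := glue_right h2 h hxy
    have hy' : β y = x := by rw [← hx, hβ]
    refine ⟨fun z => ?_, fun z => ?_⟩
    · have : (glue α x y z = x ∨ glue α x y z = y) ↔ (z = x ∨ z = y) := by
        constructor
        · rintro (e | e)
          · exact Or.inr ((glue α x y).injective (e.trans gr.symm))
          · exact Or.inl ((glue α x y).injective (e.trans gl.symm))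
        · rintro (rfl | rfl)
          · exact Or.inr gl
          · exact Or.inl gr
      simp only [this]
    · have : (β z = x ∨ β z = y) ↔ (z = x ∨ z = y) := by
        constructor
        · rintro (e | e)
          · exact Or.inr (by rw [← hβ z, e, hx])
          · exact Or.inl (by rw [← hβ z, e, hy'])
        · rintro (rfl | rfl)
          · exact Or.inr hx
          · exact Or.inl hy'
      simp only [this]
  have hl : Function.Surjective l := by
    intro c
    refine ⟨-c • ⟨_, hmem⟩, ?_⟩
    simp [l, hy, h x]
  have hker : LinearMap.ker l ≃ₗ[ZMod 2] pairInvariants α β :=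
    { toFun := fun f => ⟨f.1.1, (mem_pairInvariants_glue (sub_eq_zero.1 f.2)).1 f.1.2⟩
      invFun := fun f => ⟨⟨f.1, (mem_pairInvariants_glue (hinv f.1 f.2)).2 f.2⟩,
        sub_eq_zero.2 (hinv f.1 f.2)⟩
      map_add' := fun _ _ => rfl
      map_smul' := fun _ _ => rfl
      left_inv := fun _ => rfl
      right_inv := fun _ => rfl }
  have := LinearMap.finrank_range_add_finrank_ker l
  rw [LinearMap.range_eq_top.2 hl, finrank_top, Module.finrank_self, hker.finrank_eq] at this
  rw [if_neg hy, add_zero, ← this, add_comm]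

/-! ### Circles after surgery on all chords -/

/-- The pairing of the sides along the edges of the bands that replace all chords; the band of the
chord `v` is half-twisted when `T v`. -/
def bandPairing {n : ℕ} (T : Fin n → Bool) (s : EndSide n) : EndSide n :=
  ((s.1.1, !s.1.2), if T s.1.1 then s.2 else !s.2)

theorem bandPairing_bandPairing {n : ℕ} (T : Fin n → Bool) (s : EndSide n) :
    bandPairing T (bandPairing T s) = s := by
  obtain ⟨⟨c, β⟩, δ⟩ := s
  simp only [bandPairing, Bool.not_not]
  split_ifs <;> simp

namespace BandDiagram

/-- The number of circles after surgery on all chords, with half-twisted bands at the chords `v`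
such that `T v`. The circles that run through endpoints are counted by the dimension of the
space of functions that are constant along them. -/
noncomputable def stateCircles {n : ℕ} (D : BandDiagram n) (T : Fin n → Bool) : ℕ :=
  D.circles + Module.finrank (ZMod 2) (pairInvariants D.arc (bandPairing T))

theorem stateCircles_pos {n : ℕ} (D : BandDiagram n) (T : Fin n → Bool) :
    0 < D.stateCircles T := by
  rcases D.nonempty with h | h
  · have : Nonempty (EndSide n) := ⟨((⟨0, h⟩, false), false)⟩
    exact Nat.add_pos_right _ (finrank_pairInvariants_pos _ _)
  · exact Nat.add_pos_left h _

theorem surgeryAux_eq_bandPairing {n : ℕ} (D : BandDiagram n) (T : Fin n → Bool)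
    (s : EndSide n) : D.surgeryAux s.1.1 (T s.1.1) s = bandPairing T s := by
  obtain ⟨⟨v, β⟩, δ⟩ := s
  generalize ht : T v = t
  have h2 := glue_glue D.arc_arc ((v, false), false) (partner v t false)
  have h1 := glue_ne D.arc_ne ((v, false), false) (partner v t false)
  have a1 := glue_left D.arc_ne (x := ((v, false), false)) (y := partner v t false)
    (by simp [partner])
  have a2 := glue_right D.arc_arc D.arc_ne (x := ((v, false), false)) (y := partner v t false)
    (by simp [partner])
  have b1 : D.surgeryAux v t ((v, false), true) = partner v t true :=
    glue_left h1 (by simp [partner])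
  have b2 : D.surgeryAux v t (partner v t true) = ((v, false), true) :=
    glue_right h2 h1 (by simp [partner])
  have b3 : D.surgeryAux v t ((v, false), false) = partner v t false :=
    glue_of_pair h2 _ _ a1 (by simp) (by simp [partner]) (by simp [partner])
      (by cases t <;> simp [partner])
  have b4 : D.surgeryAux v t (partner v t false) = ((v, false), false) :=
    glue_of_pair h2 _ _ a2 (by simp [partner]) (by cases t <;> simp [partner]) (by simp)
      (by simp [partner])
  cases t <;> cases β <;> cases δ <;> simp [partner] at b1 b2 b3 b4 <;>
    simp [bandPairing, *]

theorem bandPairing_sideEquiv {n : ℕ} (v : Fin (n + 1)) (T : Fin (n + 1) → Bool)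
    (s : EndSide n) :
    bandPairing T (sideEquiv v s).1 = (sideEquiv v (bandPairing (T ∘ v.succAbove) s)).1 := rfl

theorem surgery_arc {n : ℕ} (D : BandDiagram (n + 1)) (v : Fin (n + 1)) (t : Bool)
    (s : EndSide n) :
    (sideEquiv v ((D.surgery v t).arc s)).1 = D.surgeryAux v t (sideEquiv v s).1 := by
  simp [surgery, Equiv.Perm.subtypePerm_apply]

/-- After the surgery on `v`, the sides of the endpoints of `v` form two orbits of their own, one
for each edge of the band. -/
theorem finrank_pairInvariants_surgeryAux {n : ℕ} (D : BandDiagram (n + 1)) (v : Fin (n + 1))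
    (T : Fin (n + 1) → Bool) :
    Module.finrank (ZMod 2) (pairInvariants (D.surgeryAux v (T v)) (bandPairing T)) =
      2 + Module.finrank (ZMod 2)
        (pairInvariants (D.surgery v (T v)).arc (bandPairing (T ∘ v.succAbove))) := by
  let r : pairInvariants (D.surgeryAux v (T v)) (bandPairing T) →ₗ[ZMod 2]
      (Bool → ZMod 2) ×
        pairInvariants (D.surgery v (T v)).arc (bandPairing (T ∘ v.succAbove)) :=
    { toFun := fun f => (fun δ => f.1 ((v, false), δ), ⟨fun s => f.1 (sideEquiv v s).1,
        fun s => (congrArg f.1 (D.surgery_arc v (T v) s)).trans (f.2.1 _),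
        fun s => f.2.2 (sideEquiv v s).1⟩)
      map_add' := fun _ _ => rfl
      map_smul' := fun _ _ => rfl }
  have hr : Function.Bijective r := by
    constructor
    · refine (injective_iff_map_eq_zero r).2 fun f hf => Subtype.ext (funext fun s => ?_)
      have hf1 : ∀ δ, f.1 ((v, false), δ) = 0 := fun δ => congrFun (congrArg Prod.fst hf) δ
      have hf2 : ∀ s, f.1 (sideEquiv v s).1 = 0 := fun s =>
        congrFun (congrArg Subtype.val (congrArg Prod.snd hf)) s
      by_cases hs : s.1.1 = v
      · obtain ⟨⟨c, β⟩, δ⟩ := s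
        obtain rfl : c = v := hs
        cases β
        · exact hf1 δ
        · rw [← f.2.2]
          exact hf1 _
      · simpa using hf2 ((sideEquiv v).symm ⟨s, hs⟩)
    · rintro ⟨h, g⟩
      let F : EndSide (n + 1) → ZMod 2 := fun s =>
        if hs : s.1.1 ≠ v then g.1 ((sideEquiv v).symm ⟨s, hs⟩)
        else h (if s.1.2 then (bandPairing T s).2 else s.2)
      have hF : ∀ s, F (sideEquiv v s).1 = g.1 s := fun s => by
        simp [F, (sideEquiv v s).2]
      have hb : ∀ s, F (bandPairing T s) = F s := by
        intro s
        by_cases hs : s.1.1 = v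
        · obtain ⟨⟨c, β⟩, δ⟩ := s
          obtain rfl : c = v := hs
          cases β <;> (simp [F, bandPairing]; try (cases T c <;> simp))
        · obtain ⟨s, rfl⟩ : ∃ s', s = (sideEquiv v s').1 := ⟨(sideEquiv v).symm ⟨s, hs⟩, by simp⟩
          rw [bandPairing_sideEquiv, hF, hF, g.2.2]
      refine ⟨⟨F, fun s => ?_, hb⟩, Prod.ext (funext fun δ => ?_) (Subtype.ext (funext hF))⟩
      · by_cases hs : s.1.1 = v
        · subst hs
          rw [surgeryAux_eq_bandPairing, hb]
        · obtain ⟨s, rfl⟩ : ∃ s', s = (sideEquiv v s').1 := ⟨(sideEquiv v).symm ⟨s, hs⟩, by simp⟩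
          rw [← surgery_arc, hF, hF, g.2.1]
      · simp [r, F]
  rw [(LinearEquiv.ofBijective r hr).finrank_eq, Module.finrank_prod]
  simp

/-- Surgery on all chords can begin with the chord `v`. -/
theorem stateCircles_surgery {n : ℕ} (D : BandDiagram (n + 1)) (v : Fin (n + 1))
    (T : Fin (n + 1) → Bool) :
    (D.surgery v (T v)).stateCircles (T ∘ v.succAbove) = D.stateCircles T := by
  have e1 := finrank_pairInvariants_glue (β := bandPairing T) D.arc_arc D.arc_ne
    (bandPairing_bandPairing T) (x := ((v, false), false)) (y := partner v (T v) false)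
    (by simp [partner]) rfl
  have e2 := finrank_pairInvariants_glue (β := bandPairing T)
    (glue_glue D.arc_arc ((v, false), false) (partner v (T v) false)) (glue_ne D.arc_ne _ _)
    (bandPairing_bandPairing T) (x := ((v, false), true)) (y := partner v (T v) true)
    (by simp [partner]) rfl
  have e3 := D.finrank_pairInvariants_surgeryAux v T
  have e4 : (D.surgery v (T v)).circles = D.circles + D.newCircles v (T v) := rfl
  unfold surgeryAux at e3
  unfold newCircles at e4
  unfold stateCircles
  omega

/-! ### The state sum -/

/-- The sign of a state: a factor `-1` for each half-twisted band. -/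
def stateSign {n : ℕ} (T : Fin n → Bool) : ℤ := ∏ i, if T i then -1 else 1

/-- The sum over all ways to replace the chords by bands to which the skein relations reduce the
Kauffman weight system. -/
noncomputable def stateSum (n : ℕ) (D : BandDiagram n) : ZAB :=
  varA ^ n * ∑ T : Fin n → Bool, (stateSign T : ZAB) * varB ^ (D.stateCircles T - 1)

theorem isKauffmanWeight_stateSum : IsKauffmanWeight stateSum where
  skein n D v := by
    have h : ∀ t : Bool, ∀ T' : Fin n → Bool,
        D.stateCircles (Fin.insertNthEquiv (fun _ => Bool) v (t, T')) =
          (D.surgery v t).stateCircles T' := by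
      intro t T'
      have h1 := D.stateCircles_surgery v (Fin.insertNthEquiv (fun _ => Bool) v (t, T'))
      have h2 : (Fin.insertNthEquiv (fun _ => Bool) v (t, T')) v = t := by simp
      have h3 : (Fin.insertNthEquiv (fun _ => Bool) v (t, T') : Fin (n + 1) → Bool) ∘
          v.succAbove = T' := funext fun i => by simp
      rw [h2, h3] at h1
      exact h1.symm
    rw [stateSum, ← (Fin.insertNthEquiv (fun _ => Bool) v).sum_comp, Fintype.sum_prod_type,
      Fintype.sum_bool]
    simp only [h, stateSign]
    simp only [Fin.insertNthEquiv_apply, Fin.prod_univ_succAbove _ v,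
      Fin.insertNth_apply_same, Fin.insertNth_apply_succAbove, stateSum]
    simp [Finset.sum_neg_distrib, stateSign]
    ring
  circle n D := by
    have h : ∀ T, varB ^ (D.addCircle.stateCircles T - 1) =
        varB * varB ^ (D.stateCircles T - 1) := by
      intro T
      have h1 : D.addCircle.stateCircles T = D.stateCircles T + 1 := by
        exact Nat.add_right_comm _ _ _
      have h2 := D.stateCircles_pos T
      rw [← pow_succ', h1]
      congr 1
      omega
    simp only [stateSum, h, Finset.mul_sum]
    exact Finset.sum_congr rfl fun T _ => by ring
  unknot := by
    have h : ∀ T, unknot.stateCircles T = 1 := fun T =>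
      congrArg (1 + ·) (Module.finrank_zero_of_subsingleton (R := ZMod 2)
        (M := pairInvariants unknot.arc (bandPairing T)))
    simp [stateSum, stateSign, h]

/-- Two diagrams without chords agree when they have equally many circles. -/
theorem ext_of_circles {D D' : BandDiagram 0} (h : D.circles = D'.circles) : D = D' := by
  obtain ⟨α, h1, h2, c, h3⟩ := D
  obtain ⟨α', h1', h2', c', h3'⟩ := D'
  obtain rfl : c = c' := h
  obtain rfl : α = α' := Equiv.ext fun f => f.1.1.elim0
  rfl

theorem _root_.IsKauffmanWeight.eq_stateSum {K : (n : ℕ) → BandDiagram n → ZAB}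
    (hK : IsKauffmanWeight K) : K = stateSum := by
  funext n
  induction n with
  | zero =>
    have hS := isKauffmanWeight_stateSum
    have key : ∀ c, ∀ D : BandDiagram 0, D.circles = c + 1 → K 0 D = stateSum 0 D := by
      intro c
      induction c with
      | zero =>
        intro D hD
        rw [ext_of_circles (D := D) (D' := unknot) hD, hK.unknot, hS.unknot]
      | succ c ih =>
        intro D hD
        let D' : BandDiagram 0 := { D with circles := c + 1, nonempty := Or.inr c.succ_pos }
        rw [ext_of_circles (D := D) (D' := D'.addCircle) hD, hK.circle, hS.circle, ih D' rfl]
    funext D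
    have h : 0 < D.circles := D.nonempty.resolve_left (lt_irrefl 0)
    exact key (D.circles - 1) D (by omega)
  | succ n ih =>
    funext D
    rw [hK.skein n D 0, isKauffmanWeight_stateSum.skein n D 0, ih]

end BandDiagram

/-! ### Circles of a chord diagram and the rank of its intersection matrix -/

namespace ChordDiagram

theorem val_pos_succ {n : ℕ} (D : ChordDiagram n) (p : Endpoint n) :
    (D.pos (D.succ p) : ℕ) = if (D.pos p : ℕ) + 1 = 2 * n then 0 else (D.pos p : ℕ) + 1 := by
  have key : ∀ m (i : Fin m), (finRotate m i : ℕ) = if (i : ℕ) + 1 = m then 0 else (i : ℕ) + 1 := by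
    intro m i
    cases m with
    | zero => exact i.elim0
    | succ m =>
      rw [coe_finRotate]
      simp only [Fin.ext_iff, Fin.val_last, Nat.add_right_cancel_iff]
  rw [succ, Equiv.trans_apply, Equiv.apply_symm_apply]
  exact key _ _

/-- The function on places of the circle with value `c` at the starting point that changes by
`z v` at each endpoint of the chord `v`. The place `k` follows the first `k` endpoints. -/
def jumpSum {n : ℕ} (D : ChordDiagram n) (z : Fin n → ZMod 2) (c : ZMod 2) (k : ℕ) : ZMod 2 :=
  c + ∑ q : Endpoint n, if (D.pos q : ℕ) < k then z q.1 else 0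

theorem jumpSum_zero {n : ℕ} (D : ChordDiagram n) (z : Fin n → ZMod 2) (c : ZMod 2) :
    D.jumpSum z c 0 = c := by
  simp [jumpSum]

theorem jumpSum_succ {n : ℕ} (D : ChordDiagram n) (z : Fin n → ZMod 2) (c : ZMod 2)
    (p : Endpoint n) :
    D.jumpSum z c (D.pos p + 1) = D.jumpSum z c (D.pos p) + z p.1 := by
  have h : ∀ q : Endpoint n, (if (D.pos q : ℕ) < D.pos p + 1 then z q.1 else 0) =
      (if (D.pos q : ℕ) < D.pos p then z q.1 else 0) + if p = q then z q.1 else 0 := by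
    intro q
    by_cases e : p = q
    · simp [e]
    · have : (D.pos p : ℕ) ≠ D.pos q := fun h => e (D.pos.injective (Fin.ext h))
      have h' : (D.pos q : ℕ) < D.pos p + 1 ↔ (D.pos q : ℕ) < D.pos p := by omega
      simp [e, h']
  simp only [jumpSum, h, Finset.sum_add_distrib, Finset.sum_ite_eq, Finset.mem_univ, if_true,
    add_assoc]

/-- Each chord changes the value twice, so the function closes up along the circle. -/
theorem jumpSum_two_mul {n : ℕ} (D : ChordDiagram n) (z : Fin n → ZMod 2) (c : ZMod 2) :
    D.jumpSum z c (2 * n) = c := by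
  simp only [jumpSum, Fin.is_lt, if_true, Fintype.sum_prod_type, Fintype.sum_bool,
    CharTwo.add_self_eq_zero, Finset.sum_const_zero, add_zero]

theorem jumpSum_succ_pos {n : ℕ} (D : ChordDiagram n) (z : Fin n → ZMod 2) (c : ZMod 2)
    (p : Endpoint n) :
    D.jumpSum z c (D.pos (D.succ p)) = D.jumpSum z c (D.pos p + 1) := by
  rw [val_pos_succ]
  split_ifs with h
  · rw [h, jumpSum_two_mul, jumpSum_zero]
  · rfl

open Classical in
/-- The values at the two endpoints of `v` differ by the jumps at the endpoints between them; the
chords that do not cross `v` have none or two endpoints there. -/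
theorem jumpSum_add_jumpSum {n : ℕ} (D : ChordDiagram n) (z : Fin n → ZMod 2) (c : ZMod 2)
    (v : Fin n) :
    D.jumpSum z c (D.pos (v, false) + 1) + D.jumpSum z c (D.pos (v, true) + 1) =
      z v + ∑ w, if D.intersectionGraph.Adj v w then z w else 0 := by
  have key : ∀ w : Fin n,
      (∑ β : Bool, if (D.pos (w, β) : ℕ) < D.pos (v, false) + 1 then z w else 0) +
      (∑ β : Bool, if (D.pos (w, β) : ℕ) < D.pos (v, true) + 1 then z w else 0) =
      (if v = w then z w else 0) + if D.intersectionGraph.Adj v w then z w else 0 := by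
    intro w
    have hne : ∀ p q : Endpoint n, p ≠ q → (D.pos p : ℕ) ≠ D.pos q :=
      fun p q hpq h => hpq (D.pos.injective (Fin.ext h))
    have h1 := hne (v, false) (v, true) (by simp)
    by_cases e : v = w
    · subst e
      have e1 : ¬ D.intersectionGraph.Adj v v := D.intersectionGraph.irrefl
      rw [Fintype.sum_bool, Fintype.sum_bool, if_neg e1, if_pos rfl]
      have h2 : z v + z v = 0 := CharTwo.add_self_eq_zero _
      rcases Nat.lt_or_gt_of_ne h1 with h | h
      · have h' : ¬ (D.pos (v, true) : ℕ) < D.pos (v, false) + 1 := by omega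
        have h'' : (D.pos (v, false) : ℕ) < D.pos (v, true) + 1 := by omega
        rw [if_neg h', if_pos h'', if_pos (Nat.lt_succ_self _), if_pos (Nat.lt_succ_self _), h2]
        ring
      · have h' : (D.pos (v, true) : ℕ) < D.pos (v, false) + 1 := by omega
        have h'' : ¬ (D.pos (v, false) : ℕ) < D.pos (v, true) + 1 := by omega
        rw [if_pos h', if_neg h'', if_pos (Nat.lt_succ_self _), if_pos (Nat.lt_succ_self _), h2]
        ring
    · have h2 := hne (w, false) (w, true) (by simp)
      have h3 := hne (v, false) (w, false) (by simp [e])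
      have h4 := hne (v, false) (w, true) (by simp [e])
      have h5 := hne (v, true) (w, false) (by simp [e])
      have h6 := hne (v, true) (w, true) (by simp [e])
      have h7 : z w + z w = 0 := CharTwo.add_self_eq_zero _
      rw [if_neg e]
      have hadj : D.intersectionGraph.Adj v w ↔
          (((D.pos (w, false) : ℕ) < D.pos (v, false) + 1 ↔
            (D.pos (w, true) : ℕ) < D.pos (v, false) + 1) ↔
          ¬ ((D.pos (w, false) : ℕ) < D.pos (v, true) + 1 ↔
            (D.pos (w, true) : ℕ) < D.pos (v, true) + 1)) := by
        simp only [intersectionGraph, AlternateFrom, Bool.exists_bool, Fin.lt_def, Bool.not_true,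
          Bool.not_false]
        clear hne h7 e
        generalize (D.pos (v, false) : ℕ) = a at *
        generalize (D.pos (v, true) : ℕ) = b at *
        generalize (D.pos (w, false) : ℕ) = c at *
        generalize (D.pos (w, true) : ℕ) = d at *
        grind
      rw [Fintype.sum_bool, Fintype.sum_bool]
      simp only [hadj]
      by_cases g1 : (D.pos (w, false) : ℕ) < D.pos (v, false) + 1 <;>
      by_cases g2 : (D.pos (w, true) : ℕ) < D.pos (v, false) + 1 <;>
      by_cases g3 : (D.pos (w, false) : ℕ) < D.pos (v, true) + 1 <;>
      by_cases g4 : (D.pos (w, true) : ℕ) < D.pos (v, true) + 1 <;>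
      simp only [g1, g2, g3, g4, if_true, if_false, iff_self, not_true, not_false_iff, iff_true,
        iff_false, add_zero, zero_add, h7]
  have h0 : c + c = 0 := CharTwo.add_self_eq_zero _
  calc _ = c + c + ∑ w,
      ((∑ β : Bool, if (D.pos (w, β) : ℕ) < D.pos (v, false) + 1 then z w else 0) +
      (∑ β : Bool, if (D.pos (w, β) : ℕ) < D.pos (v, true) + 1 then z w else 0)) := by
        simp only [jumpSum, Fintype.sum_prod_type, Finset.sum_add_distrib]
        ring
    _ = _ := by
        simp only [key, Finset.sum_add_distrib, h0, zero_add, Finset.sum_ite_eq, Finset.mem_univ,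
          if_true]

/-- The chords with half-twisted bands; they are the marked vertices of the intersection graph. -/
def twisted {n : ℕ} (T : Fin n → Bool) : Finset (Fin n) := Finset.univ.filter fun v => T v = true

theorem markedAdjMatrix_mulVec {n : ℕ} (D : ChordDiagram n) (T : Fin n → Bool)
    (z : Fin n → ZMod 2) (c : ZMod 2) (v : Fin n) :
    (markedAdjMatrix D.intersectionGraph (twisted T)).mulVec z v =
      D.jumpSum z c (D.pos (v, false) + 1) + D.jumpSum z c (D.pos (v, true) + 1) +
        if T v then 0 else z v := by
  classical
  have h : ∀ w, markedAdjMatrix D.intersectionGraph (twisted T) v w * z w =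
      (if D.intersectionGraph.Adj v w then z w else 0) +
        if v = w then (if T v then z v else 0) else 0 := by
    intro w
    by_cases e : v = w
    · subst e
      by_cases h : T v <;> simp [markedAdjMatrix, twisted, h]
    · simp [markedAdjMatrix, e]
  have h2 : z v + z v = 0 := CharTwo.add_self_eq_zero _
  rw [jumpSum_add_jumpSum, Matrix.mulVec, dotProduct]
  simp only [h, Finset.sum_add_distrib, Finset.sum_ite_eq, Finset.mem_univ, if_true]
  by_cases h : T v
  · simp [h, add_comm]
  · simp [h, add_right_comm, h2]

theorem mem_pairInvariants_toBand {n : ℕ} (D : ChordDiagram n) (τ : EndSide n → EndSide n)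
    (f : EndSide n → ZMod 2) :
    f ∈ pairInvariants D.toBand.arc τ ↔
      (∀ p, f (D.succ p, false) = f (p, true)) ∧ ∀ s, f (τ s) = f s := by
  refine and_congr_left fun _ => ⟨fun h p => h (p, true), fun h s => ?_⟩
  obtain ⟨p, δ⟩ := s
  cases δ
  · have := h (D.succ.symm p)
    rw [Equiv.apply_symm_apply] at this
    exact this.symm
  · exact h p

/-- The function on the sides of endpoints given by `jumpSum`. -/
def jumpFun {n : ℕ} (D : ChordDiagram n) (z : Fin n → ZMod 2) (c : ZMod 2) (s : EndSide n) :
    ZMod 2 :=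
  D.jumpSum z c (D.pos s.1 + s.2.toNat)

theorem jumpFun_true {n : ℕ} (D : ChordDiagram n) (z : Fin n → ZMod 2) (c : ZMod 2)
    (p : Endpoint n) : D.jumpFun z c (p, true) = D.jumpFun z c (p, false) + z p.1 :=
  D.jumpSum_succ z c p

theorem jumpFun_mem {n : ℕ} (D : ChordDiagram n) (T : Fin n → Bool) (z : Fin n → ZMod 2)
    (c : ZMod 2) :
    D.jumpFun z c ∈ pairInvariants D.toBand.arc (bandPairing T) ↔
      (markedAdjMatrix D.intersectionGraph (twisted T)).mulVec z = 0 := by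
  have h1 : ∀ p, D.jumpFun z c (D.succ p, false) = D.jumpFun z c (p, true) :=
    fun p => D.jumpSum_succ_pos z c p
  rw [mem_pairInvariants_toBand, and_iff_right h1, funext_iff]
  have h2 : ∀ v, (markedAdjMatrix D.intersectionGraph (twisted T)).mulVec z v =
      D.jumpFun z c ((v, false), true) + D.jumpFun z c ((v, true), true) +
        if T v then 0 else z v := fun v => D.markedAdjMatrix_mulVec T z c v
  simp only [h2, Pi.zero_apply]
  have h3 : ∀ x : ZMod 2, x + x = 0 := CharTwo.add_self_eq_zero
  constructor
  · intro h v
    have e := h ((v, true), true)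
    simp only [bandPairing, jumpFun_true] at e ⊢
    by_cases ht : T v <;> simp [ht, jumpFun_true] at e ⊢ <;> rw [e]
    · exact h3 _
    · linear_combination h3 (D.jumpFun z c ((v, true), false)) + 2 * h3 (z v)
  · rintro h ⟨⟨v, β⟩, δ⟩
    have e := h v
    simp only [bandPairing, jumpFun_true] at e ⊢
    have h4 := h3 (D.jumpFun z c ((v, true), false))
    have h5 := h3 (D.jumpFun z c ((v, false), false))
    have h6 := h3 (z v)
    by_cases ht : T v <;> cases β <;> cases δ <;> simp [ht, jumpFun_true] at e ⊢ <;> grind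

/-- An invariant function changes by the same amount at both endpoints of a chord, so it is
given by `jumpSum`. -/
theorem exists_jumpFun_eq {n : ℕ} (D : ChordDiagram n) (T : Fin n → Bool) (hn : 0 < n)
    {f : EndSide n → ZMod 2} (hf : f ∈ pairInvariants D.toBand.arc (bandPairing T)) :
    ∃ z c, D.jumpFun z c = f := by
  rw [mem_pairInvariants_toBand] at hf
  obtain ⟨h1, h2⟩ := hf
  have h3 : ∀ x : ZMod 2, x + x = 0 := CharTwo.add_self_eq_zero
  let z : Fin n → ZMod 2 := fun v => f ((v, false), true) + f ((v, false), false)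
  let c : ZMod 2 := f (D.pos.symm ⟨0, by omega⟩, false)
  have hz : ∀ p : Endpoint n, f (p, true) = f (p, false) + z p.1 := by
    rintro ⟨v, β⟩
    have e0 := h2 ((v, false), false)
    have e1 := h2 ((v, false), true)
    have h4 := h3 (f ((v, false), false))
    have h5 := h3 (f ((v, false), true))
    by_cases ht : T v <;> cases β <;> simp [ht, bandPairing, z] at e0 e1 ⊢ <;> grind
  have key : ∀ k (hk : k < 2 * n), D.jumpSum z c k = f (D.pos.symm ⟨k, hk⟩, false) := by
    intro k
    induction k with
    | zero => exact fun _ => D.jumpSum_zero z c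
    | succ k ih =>
      intro hk
      have e := D.jumpSum_succ z c (D.pos.symm ⟨k, by omega⟩)
      have hs : D.succ (D.pos.symm ⟨k, by omega⟩) = D.pos.symm ⟨k + 1, hk⟩ := by
        rw [← D.pos.apply_eq_iff_eq, Fin.ext_iff, val_pos_succ]
        simp only [Equiv.apply_symm_apply]
        rw [if_neg (by omega)]
      rw [Equiv.apply_symm_apply] at e
      rw [e, ih (by omega), ← hz, ← h1, hs]
  refine ⟨z, c, funext fun s => ?_⟩
  obtain ⟨p, δ⟩ := s
  have h0 : D.jumpFun z c (p, false) = f (p, false) := by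
    have := key (D.pos p) (D.pos p).2
    rwa [Fin.eta, Equiv.symm_apply_apply] at this
  cases δ
  · exact h0
  · rw [jumpFun_true, h0, hz]

/-- Surgery on all chords of a chord diagram leaves one circle more than the corank of the
adjacency matrix. -/
theorem stateCircles_toBand {n : ℕ} (D : ChordDiagram n) (T : Fin n → Bool) :
    D.toBand.stateCircles T + (markedAdjMatrix D.intersectionGraph (twisted T)).rank = n + 1 := by
  rcases Nat.eq_zero_or_pos n with rfl | hn
  · have h : D.toBand.stateCircles T = 1 :=
      congrArg (1 + ·) (Module.finrank_zero_of_subsingleton (R := ZMod 2)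
        (M := pairInvariants D.toBand.arc (bandPairing T)))
    have h' := (markedAdjMatrix D.intersectionGraph (twisted T)).rank_le_width
    omega
  let A := markedAdjMatrix D.intersectionGraph (twisted T)
  let F : LinearMap.ker A.mulVecLin × ZMod 2 →ₗ[ZMod 2]
      pairInvariants D.toBand.arc (bandPairing T) :=
    { toFun := fun x => ⟨D.jumpFun x.1.1 x.2, (D.jumpFun_mem T _ _).2 x.1.2⟩
      map_add' := fun x y => by
        ext s
        simp only [jumpFun, jumpSum, Prod.fst_add, Prod.snd_add, Submodule.coe_add, Pi.add_apply,
          ← Finset.sum_filter, Finset.sum_add_distrib]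
        ring
      map_smul' := fun a x => by
        ext s
        simp only [jumpFun, jumpSum, Prod.smul_fst, Prod.smul_snd, SetLike.val_smul, Pi.smul_apply,
          ← Finset.sum_filter, smul_eq_mul, ← Finset.mul_sum, RingHom.id_apply]
        ring }
  have hF : Function.Bijective F := by
    constructor
    · refine (injective_iff_map_eq_zero F).2 fun x hx => ?_
      have h : ∀ s, D.jumpFun x.1.1 x.2 s = 0 := fun s => congrFun (congrArg Subtype.val hx) s
      refine Prod.ext (Subtype.ext (funext fun v => ?_)) ?_
      · have := D.jumpFun_true x.1.1 x.2 (v, false)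
        rw [h, h, zero_add] at this
        exact this.symm
      · have := h (D.pos.symm ⟨0, by omega⟩, false)
        simpa [jumpFun, jumpSum_zero] using this
    · intro f
      obtain ⟨z, c, hzc⟩ := D.exists_jumpFun_eq T hn f.2
      exact ⟨(⟨z, (D.jumpFun_mem T z c).1 (hzc ▸ f.2)⟩, c), Subtype.ext hzc⟩
  have h1 := (LinearEquiv.ofBijective F hF).finrank_eq
  have h2 := LinearMap.finrank_range_add_finrank_ker A.mulVecLin
  have h3 : D.toBand.circles = 0 := if_neg hn.ne'
  rw [Module.finrank_prod, Module.finrank_self] at h1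
  rw [Module.finrank_pi, Fintype.card_fin] at h2
  have h4 : A.rank = Module.finrank (ZMod 2) (LinearMap.range A.mulVecLin) := rfl
  change _ + A.rank = _
  rw [BandDiagram.stateCircles, h3]
  omega

end ChordDiagram

/-! ### Sliding an endpoint along a band -/

/-- The function `f` is constant along the arcs that arise from the pairing `α` when an endpoint
with the sides `y` and `y'` is put on the arc that starts at the side `z`, with `y` facing `z`. -/
def SplicedInvariant {X : Type*} (α : X → X) (z y y' : X) (f : X → ZMod 2) : Prop :=
  f z = f y ∧ f (α z) = f y' ∧ ∀ r, r ≠ z → r ≠ α z → r ≠ y → r ≠ y' → f (α r) = f r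

/-- A function that is constant also along the band edge from `z` to `z'` stays so when the spliced
endpoint slides along this edge: its far side `y'` then faces `z'`, and the edge lies on the other
side of the endpoint, so that its ends take the value at `y'`. -/
theorem SplicedInvariant.slide {X : Type*} [DecidableEq X] {α : X → X} {z z' y y' : X}
    {f : X → ZMod 2} (h2 : ∀ r, α (α r) = r) (h : ∀ r, α r ≠ r) (hzz : z ≠ z')
    (hy : y ≠ z ∧ y ≠ z') (hy' : y' ≠ z ∧ y' ≠ z') (hf : SplicedInvariant α z y y' f)
    (hfz : f z' = f z) :
    SplicedInvariant α z' y' y (f ∘ fun r => if r = z ∨ r = z' then y' else r) := by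
  obtain ⟨f1, f2, f3⟩ := hf
  have hinj : ∀ r t, α r = t → r = α t := fun r t e => by rw [← e, h2]
  refine ⟨by simp [hy'], ?_, fun r r1 r2 r3 r4 => ?_⟩
  · by_cases e : α z' = z
    · have e' : α z = z' := by rw [← e, h2]
      have : f y' = f y := by rw [← f1, ← f2, e', hfz]
      simp [hy, e, this]
    · have := f3 z' hzz.symm (fun e' => e (by rw [e', h2])) hy.2.symm hy'.2.symm
      simp [hy, e, h z', this, hfz, f1]
  · have hr' : α r ≠ z' := fun e => r2 (hinj _ _ e)
    by_cases e : r = z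
    · subst e
      simp [h r, hr', f2]
    · by_cases e' : α r = z
      · have : r = α z := hinj _ _ e'
        simp [e', e, r1]
        rw [this, f2]
      · simp only [Function.comp_apply, e, r1, e', hr', or_self, if_false]
        exact f3 r e (fun e'' => e' (by rw [e'', h2])) r4 r3

/-- An endpoint next to an edge of a band can slide along this edge from one end `z` to the
other end `z'`. -/
theorem finrank_pairInvariants_slide {X : Type*} [DecidableEq X] {α σ σ' τ : X → X}
    {z z' y y' : X} (h2 : ∀ r, α (α r) = r) (h : ∀ r, α r ≠ r) (hzz : z ≠ z')
    (hτ : ∀ r, τ (τ r) = r) (hz : τ z = z') (hy : y ≠ z ∧ y ≠ z') (hy' : y' ≠ z ∧ y' ≠ z')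
    (hσ : ∀ f : X → ZMod 2, (∀ r, f (σ r) = f r) ↔ SplicedInvariant α z y y' f)
    (hσ' : ∀ f : X → ZMod 2, (∀ r, f (σ' r) = f r) ↔ SplicedInvariant α z' y' y f) :
    Module.finrank (ZMod 2) (pairInvariants σ τ) =
      Module.finrank (ZMod 2) (pairInvariants σ' τ) := by
  have hz' : τ z' = z := by rw [← hz, hτ]
  have hmem : ∀ r, (τ r = z ∨ τ r = z') ↔ (r = z ∨ r = z') := by
    intro r
    constructor
    · rintro (e | e)
      · exact Or.inr (by rw [← hτ r, e, hz])
      · exact Or.inl (by rw [← hτ r, e, hz'])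
    · rintro (rfl | rfl)
      · exact Or.inr hz
      · exact Or.inl hz'
  have hτm : ∀ (w : X) (f : X → ZMod 2), (∀ r, f (τ r) = f r) → ∀ r,
      (f ∘ fun r => if r = z ∨ r = z' then w else r) (τ r) =
        (f ∘ fun r => if r = z ∨ r = z' then w else r) r := by
    intro w f hf r
    simp only [Function.comp_apply, hmem]
    split_ifs
    · rfl
    · exact hf r
  refine finrank_pairInvariants_congr (fun r => if r = z ∨ r = z' then y' else r)
    (fun r => if r = z ∨ r = z' then y else r) (fun f hf => ?_) (fun f hf => ?_)
  · have hs := (hσ f).1 hf.1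
    have hfz : f z' = f z := by rw [← hz, hf.2]
    refine ⟨⟨(hσ' _).2 (hs.slide h2 h hzz hy hy' hfz), hτm y' f hf.2⟩, funext fun r => ?_⟩
    by_cases e : r = z ∨ r = z'
    · have : f r = f z := by rcases e with rfl | rfl <;> simp [hfz]
      simp [e, hy, this, hs.1]
    · simp [e]
  · have hs := (hσ' f).1 hf.1
    have hfz : f z = f z' := by rw [← hz, hf.2]
    have key := hs.slide h2 h hzz.symm hy'.symm hy.symm hfz
    simp only [or_comm (b := _ = z)] at key
    refine ⟨⟨(hσ _).2 key, hτm y f hf.2⟩, funext fun r => ?_⟩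
    by_cases e : r = z ∨ r = z'
    · have : f r = f z' := by rcases e with rfl | rfl <;> simp [hfz]
      simp [e, hy', this, hs.1]
    · simp [e]

/-- The variant of `finrank_pairInvariants_slide` in which the sides of the endpoint that slides
are exchanged afterwards. -/
theorem finrank_pairInvariants_slide_swap {X : Type*} [DecidableEq X] {α σ σ' τ τ' : X → X}
    {z z' y y' : X} (h2 : ∀ r, α (α r) = r) (h : ∀ r, α r ≠ r) (hzz : z ≠ z')
    (hτ : ∀ r, τ (τ r) = r) (hz : τ z = z') (hy : y ≠ z ∧ y ≠ z') (hy' : y' ≠ z ∧ y' ≠ z')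
    (hα : α y = y') (hττ : ∀ r, τ' (Equiv.swap y y' r) = Equiv.swap y y' (τ r))
    (hσ : ∀ f : X → ZMod 2, (∀ r, f (σ r) = f r) ↔ SplicedInvariant α z y y' f)
    (hσ' : ∀ f : X → ZMod 2, (∀ r, f (σ' r) = f r) ↔ SplicedInvariant α z' y y' f) :
    Module.finrank (ZMod 2) (pairInvariants σ τ) =
      Module.finrank (ZMod 2) (pairInvariants σ' τ') := by
  let e := Equiv.swap y y'
  have he : ∀ r, e (e r) = r := Equiv.swap_apply_self y y'
  have he' : ∀ f : X → ZMod 2, (f ∘ e) ∘ e = f := fun f => funext fun r => congrArg f (he r)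
  have hα' : α y' = y := by rw [← hα, h2]
  have hαz' : α z' ≠ y ∧ α z' ≠ y' := by
    constructor <;> intro hc
    · exact hy'.2 (by rw [← hα, ← hc, h2])
    · exact hy.2 (by rw [← hα', ← hc, h2])
  have hconj : ∀ f : X → ZMod 2, (∀ r, f (e (σ' (e r))) = f r) ↔
      SplicedInvariant α z' y' y f := by
    intro f
    have h1 : (∀ r, f (e (σ' (e r))) = f r) ↔ ∀ r, (f ∘ e) (σ' r) = (f ∘ e) r :=
      ⟨fun hc r => by simpa [he] using hc (e r), fun hc r => by simpa [he] using hc (e r)⟩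
    rw [h1, hσ']
    have e1 : e z' = z' := Equiv.swap_apply_of_ne_of_ne hy.2.symm hy'.2.symm
    have e2 : e (α z') = α z' := Equiv.swap_apply_of_ne_of_ne hαz'.1 hαz'.2
    have e3 : e y = y' := Equiv.swap_apply_left y y'
    have e4 : e y' = y := Equiv.swap_apply_right y y'
    simp only [SplicedInvariant, Function.comp_apply, e1, e2, e3, e4]
    refine and_congr_right fun _ => and_congr_right fun _ => forall_congr' fun r => ?_
    have hr : r ≠ y → r ≠ y' → (f (e (α r)) = f (e r) ↔ f (α r) = f r) := by
      intro r1 r2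
      have e5 : e r = r := Equiv.swap_apply_of_ne_of_ne r1 r2
      have e6 : e (α r) = α r := Equiv.swap_apply_of_ne_of_ne
        (fun hc => r2 (by rw [← hα, ← hc, h2])) (fun hc => r1 (by rw [← hα', ← hc, h2]))
      rw [e5, e6]
    tauto
  rw [finrank_pairInvariants_slide h2 h hzz hτ hz hy hy' hσ hconj]
  have hττ' : ∀ r, τ (e r) = e (τ' r) := fun r => by
    have := congrArg e (hττ (e r))
    rw [he, he] at this
    exact this.symm
  refine finrank_pairInvariants_congr e e (fun f hf => ⟨⟨fun r => ?_, fun r => ?_⟩, he' f⟩)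
    (fun f hf => ⟨⟨fun r => ?_, fun r => ?_⟩, he' f⟩)
  · simpa [he] using hf.1 (e r)
  · simp [← hττ', hf.2]
  · simp [he, hf.1]
  · have := hττ r
    change f (e (τ r)) = f (e r)
    rw [← this, hf.2]

namespace ChordDiagram

/-- The pairing of sides along the arcs that belong to a cyclic order of the endpoints. -/
def arcPairing {n : ℕ} (s : Equiv.Perm (Endpoint n)) (f : EndSide n) : EndSide n :=
  if f.2 then (s f.1, false) else (s.symm f.1, true)

theorem arcPairing_arcPairing {n : ℕ} (s : Equiv.Perm (Endpoint n)) (f : EndSide n) :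
    arcPairing s (arcPairing s f) = f := by
  obtain ⟨p, δ⟩ := f
  cases δ <;> simp [arcPairing]

theorem arcPairing_ne {n : ℕ} (s : Equiv.Perm (Endpoint n)) (f : EndSide n) :
    arcPairing s f ≠ f := by
  obtain ⟨p, δ⟩ := f
  cases δ <;> simp [arcPairing]

theorem invariant_arc_iff {n : ℕ} (D : ChordDiagram n) (f : EndSide n → ZMod 2) :
    (∀ s, f (D.toBand.arc s) = f s) ↔ ∀ p, f (D.succ p, false) = f (p, true) := by
  have := D.mem_pairInvariants_toBand id f
  simpa [mem_pairInvariants] using this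

/-- The permutation `swap p x * s` puts `x` on the arc of `s` that ends at the arriving side of `p`,
and the leaving side of `x` faces `p`. -/
theorem invariant_iff_of_insert_before {n : ℕ} (D : ChordDiagram n)
    {s : Equiv.Perm (Endpoint n)} {x p : Endpoint n} (hs : s x = x) (hpx : p ≠ x)
    (hD : D.succ = Equiv.swap p x * s) (f : EndSide n → ZMod 2) :
    (∀ r, f (D.toBand.arc r) = f r) ↔
      SplicedInvariant (arcPairing s) (p, false) (x, true) (x, false) f := by
  rw [invariant_arc_iff, hD]
  have hsx : s.symm x = x := by rw [Equiv.symm_apply_eq, hs]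
  have hw : s.symm p ≠ x := fun h => hpx (by rw [← s.apply_symm_apply p, h, hs])
  constructor
  · intro h
    refine ⟨by simpa [hs] using h x, ?_, ?_⟩
    · simpa [arcPairing] using (h (s.symm p)).symm
    · have key : ∀ r, r ≠ x → r ≠ s.symm p → f (s r, false) = f (r, true) := by
        intro r r1 r2
        have := h r
        rwa [Equiv.Perm.mul_apply, Equiv.swap_apply_of_ne_of_ne
          (fun e => r2 (by rw [← e, Equiv.symm_apply_apply]))
          (fun e => r1 (by rw [← s.symm_apply_apply r, e, hsx]))] at this
      rintro ⟨r, δ⟩ r1 r2 r3 r4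
      cases δ
      · have hr1 : r ≠ p := fun e => r1 (by rw [e])
        have hr2 : r ≠ x := fun e => r4 (by rw [e])
        have := key (s.symm r) (fun e => hr2 (by rw [← s.apply_symm_apply r, e, hs]))
          (fun e => hr1 (s.symm.injective e))
        rw [Equiv.apply_symm_apply] at this
        exact this.symm
      · exact key r (fun e => r3 (by rw [e])) (fun e => r2 (by rw [e]; rfl))
  · rintro ⟨h1, h2, h3⟩ r
    rw [Equiv.Perm.mul_apply]
    by_cases r1 : r = x
    · rw [r1, hs, Equiv.swap_apply_right, h1]
    by_cases r2 : r = s.symm p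
    · rw [r2, Equiv.apply_symm_apply, Equiv.swap_apply_left]
      exact h2.symm
    rw [Equiv.swap_apply_of_ne_of_ne (fun e => r2 (by rw [← e, Equiv.symm_apply_apply]))
      (fun e => r1 (by rw [← s.symm_apply_apply r, e, hsx]))]
    exact h3 (r, true) (by simp) (by simpa [arcPairing] using r2) (by simpa using r1) (by simp)

/-- The permutation `s * swap p x` puts `x` on the arc of `s` that starts at the leaving side of
`p`, and the arriving side of `x` faces `p`. -/
theorem invariant_iff_of_insert_after {n : ℕ} (D : ChordDiagram n)
    {s : Equiv.Perm (Endpoint n)} {x p : Endpoint n} (hs : s x = x)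
    (hD : D.succ = s * Equiv.swap p x) (f : EndSide n → ZMod 2) :
    (∀ r, f (D.toBand.arc r) = f r) ↔
      SplicedInvariant (arcPairing s) (p, true) (x, false) (x, true) f := by
  rw [invariant_arc_iff, hD]
  constructor
  · intro h
    refine ⟨by simpa [hs] using (h p).symm, by simpa [arcPairing] using h x, ?_⟩
    have key : ∀ r, r ≠ x → r ≠ p → f (s r, false) = f (r, true) := by
      intro r r1 r2
      have := h r
      rwa [Equiv.Perm.mul_apply, Equiv.swap_apply_of_ne_of_ne r2 r1] at this
    rintro ⟨r, δ⟩ r1 r2 r3 r4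
    cases δ
    · have hr1 : r ≠ x := fun e => r3 (by rw [e])
      have hr2 : r ≠ s p := fun e => r2 (by rw [e]; rfl)
      have := key (s.symm r) (fun e => hr1 (by rw [← s.apply_symm_apply r, e, hs]))
        (fun e => hr2 (by rw [← e, Equiv.apply_symm_apply]))
      rw [Equiv.apply_symm_apply] at this
      exact this.symm
    · exact key r (fun e => r4 (by rw [e])) (fun e => r1 (by rw [e]))
  · rintro ⟨h1, h2, h3⟩ r
    rw [Equiv.Perm.mul_apply]
    by_cases r1 : r = x
    · rw [r1, Equiv.swap_apply_right]
      exact h2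
    by_cases r2 : r = p
    · rw [r2, Equiv.swap_apply_left, hs, h1]
    rw [Equiv.swap_apply_of_ne_of_ne r2 r1]
    exact h3 (r, true) (by simpa using r2) (by simp [arcPairing]) (by simp) (by simpa using r1)

/-- When the chord with the endpoints `p` and `q` is replaced by an untwisted band, an endpoint just
before `p` can slide to the place just after `q`. -/
theorem stateCircles_slide_of_untwisted {n : ℕ} {D D' : ChordDiagram n}
    {s : Equiv.Perm (Endpoint n)} {x p q : Endpoint n} (hs : s x = x) (hpq : p ≠ q)
    (hc : p.1 = q.1) (hx : p.1 ≠ x.1) (hD : D.succ = Equiv.swap p x * s)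
    (hD' : D'.succ = s * Equiv.swap q x) {T : Fin n → Bool} (hT : T p.1 = false) :
    D.toBand.stateCircles T = D'.toBand.stateCircles T := by
  have hpx : p ≠ x := fun e => hx (by rw [e])
  have hqx : q ≠ x := fun e => hx (by rw [hc, e])
  have hq : bandPairing T (p, false) = (q, true) := by
    obtain ⟨v, β⟩ := p
    obtain ⟨w, γ⟩ := q
    obtain rfl : v = w := hc
    have hT' : T v = false := hT
    have : (!β) = γ := by cases β <;> cases γ <;> simp at hpq ⊢
    simp [bandPairing, hT', this]
  exact congrArg (D.toBand.circles + ·) (finrank_pairInvariants_slide (arcPairing_arcPairing s)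
    (arcPairing_ne s) (by simp) (bandPairing_bandPairing T) hq (by simp [hqx.symm])
    (by simp [hpx.symm]) (D.invariant_iff_of_insert_before hs hpx hD)
    (D'.invariant_iff_of_insert_after hs hD'))

/-- Exchanging the two types of band for the chord of `x` amounts to reversing the local orientation
at the one endpoint `x`. -/
theorem bandPairing_update {n : ℕ} (T : Fin n → Bool) (x : Endpoint n) (δ : Bool)
    (r : EndSide n) :
    bandPairing (Function.update T x.1 (!T x.1)) (Equiv.swap (x, δ) (x, !δ) r) =
      Equiv.swap (x, δ) (x, !δ) (bandPairing T r) := by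
  obtain ⟨⟨c, β⟩, ε⟩ := r
  obtain ⟨v, γ⟩ := x
  by_cases h : c = v
  · subst h
    by_cases hT : T c <;> cases β <;> cases γ <;> cases δ <;> cases ε <;>
      simp [Equiv.swap_apply_def, bandPairing, hT]
  · simp [Equiv.swap_apply_def, bandPairing, h]

theorem bandPairing_of_twisted {n : ℕ} {T : Fin n → Bool} {p q : Endpoint n} (hpq : p ≠ q)
    (hc : p.1 = q.1) (hT : T p.1 = true) (δ : Bool) : bandPairing T (p, δ) = (q, δ) := by
  obtain ⟨v, β⟩ := p
  obtain ⟨w, γ⟩ := q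
  obtain rfl : v = w := hc
  have hT' : T v = true := hT
  have : (!β) = γ := by cases β <;> cases γ <;> simp at hpq ⊢
  simp [bandPairing, hT', this]

/-- When the chord with the endpoints `p` and `q` is replaced by a half-twisted band, an endpoint
just before `p` can slide to the place just before `q`, but it arrives there with the opposite
local orientation, which exchanges the two types of band for its own chord. -/
theorem stateCircles_slide_before_of_twisted {n : ℕ} {D D' : ChordDiagram n}
    {s : Equiv.Perm (Endpoint n)} {x p q : Endpoint n} (hs : s x = x) (hpq : p ≠ q)
    (hc : p.1 = q.1) (hx : p.1 ≠ x.1) (hD : D.succ = Equiv.swap p x * s)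
    (hD' : D'.succ = Equiv.swap q x * s) {T : Fin n → Bool} (hT : T p.1 = true) :
    D.toBand.stateCircles T = D'.toBand.stateCircles (Function.update T x.1 (!T x.1)) := by
  have hpx : p ≠ x := fun e => hx (by rw [e])
  have hqx : q ≠ x := fun e => hx (by rw [hc, e])
  exact congrArg (D.toBand.circles + ·) (finrank_pairInvariants_slide_swap
    (arcPairing_arcPairing s) (arcPairing_ne s) (by simp [hpq]) (bandPairing_bandPairing T)
    (bandPairing_of_twisted hpq hc hT false) (by simp) (by simp [hpx.symm, hqx.symm])
    (by simp [arcPairing, hs]) (bandPairing_update T x true)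
    (D.invariant_iff_of_insert_before hs hpx hD) (D'.invariant_iff_of_insert_before hs hqx hD'))

theorem stateCircles_slide_after_of_twisted {n : ℕ} {D D' : ChordDiagram n}
    {s : Equiv.Perm (Endpoint n)} {x p q : Endpoint n} (hs : s x = x) (hpq : p ≠ q)
    (hc : p.1 = q.1) (hx : p.1 ≠ x.1) (hD : D.succ = s * Equiv.swap p x)
    (hD' : D'.succ = s * Equiv.swap q x) {T : Fin n → Bool} (hT : T p.1 = true) :
    D.toBand.stateCircles T = D'.toBand.stateCircles (Function.update T x.1 (!T x.1)) := by
  have hpx : p ≠ x := fun e => hx (by rw [e])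
  have hqx : q ≠ x := fun e => hx (by rw [hc, e])
  have hsx : s.symm x = x := by rw [Equiv.symm_apply_eq, hs]
  exact congrArg (D.toBand.circles + ·) (finrank_pairInvariants_slide_swap
    (arcPairing_arcPairing s) (arcPairing_ne s) (by simp [hpq]) (bandPairing_bandPairing T)
    (bandPairing_of_twisted hpq hc hT true) (by simp) (by simp [hpx.symm, hqx.symm])
    (by simp [arcPairing, hsx]) (bandPairing_update T x false)
    (D.invariant_iff_of_insert_after hs hD) (D'.invariant_iff_of_insert_after hs hD'))

/-! ### The alternating sum over the states -/

/-- The alternating sum over all ways to replace the chords by bands of a function `φ` of the number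
of circles. Both the Kauffman weight system and the polynomial `S` have this form. -/
noncomputable def stateTransform {n : ℕ} {M : Type*} [AddCommGroup M] (φ : ℕ → M)
    (D : ChordDiagram n) : M :=
  ∑ T : Fin n → Bool, BandDiagram.stateSign T • φ (D.toBand.stateCircles T)

theorem Equivalent.stateTransform_eq {n : ℕ} {M : Type*} [AddCommGroup M] (φ : ℕ → M)
    {D D' : ChordDiagram n} (h : D.Equivalent D') :
    stateTransform φ D = stateTransform φ D' := by
  obtain ⟨e, he, hs⟩ := h
  let g : Fin n → Fin n := fun v => (e (v, false)).1
  have hg : ∀ p : Endpoint n, g p.1 = (e p).1 := fun p => (he (p.1, false) p).1 rfl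
  have hinj : Function.Injective g := fun v w hvw => (he (v, false) (w, false)).2 hvw
  let G : Fin n ≃ Fin n := Equiv.ofBijective g (Finite.injective_iff_bijective.1 hinj)
  have hflip : ∀ v β, e (v, !β) = ((e (v, β)).1, !(e (v, β)).2) := by
    intro v β
    have h1 : (e (v, β)).1 = (e (v, !β)).1 := (he (v, β) (v, !β)).1 rfl
    have h2 : e (v, β) ≠ e (v, !β) := fun hc => by
      have := congrArg Prod.snd (e.injective hc)
      simp at this
    refine Prod.ext h1.symm ?_
    have h3 : (e (v, β)).2 ≠ (e (v, !β)).2 := fun hc => h2 (Prod.ext h1 hc)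
    exact Bool.eq_not_iff.2 h3.symm
  have hband : ∀ (T : Fin n → Bool) (p : Endpoint n) (δ : Bool),
      bandPairing T (e p, δ) =
        (e (bandPairing (T ∘ g) (p, δ)).1, (bandPairing (T ∘ g) (p, δ)).2) := by
    rintro T ⟨v, β⟩ δ
    simp only [bandPairing, Function.comp_apply, hg (v, β), hflip]
  have hcirc : ∀ T : Fin n → Bool,
      D.toBand.stateCircles (T ∘ g) = D'.toBand.stateCircles T := by
    intro T
    refine congrArg (D.toBand.circles + ·) (finrank_pairInvariants_congr
      (fun s => (e.symm s.1, s.2)) (fun s => (e s.1, s.2)) (fun f hf => ?_) (fun f hf => ?_))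
    · rw [mem_pairInvariants_toBand] at hf ⊢
      refine ⟨⟨fun p => ?_, fun s => ?_⟩, funext fun s => by simp⟩
      · have := hs (e.symm p)
        rw [Equiv.apply_symm_apply] at this
        simpa [← this] using hf.1 (e.symm p)
      · obtain ⟨p, δ⟩ := s
        obtain ⟨p, rfl⟩ := e.surjective p
        simpa [hband] using hf.2 (p, δ)
    · rw [mem_pairInvariants_toBand] at hf ⊢
      refine ⟨⟨fun p => ?_, fun s => ?_⟩, funext fun s => by simp⟩
      · simpa [hs] using hf.1 (e p)
      · have := hf.2 (e s.1, s.2)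
        rwa [hband] at this
  refine (Fintype.sum_equiv (Equiv.arrowCongr G.symm (Equiv.refl Bool)) _ _ fun T => ?_).symm
  have h1 : Equiv.arrowCongr G.symm (Equiv.refl Bool) T = T ∘ g := rfl
  have h2 : BandDiagram.stateSign (T ∘ g) = BandDiagram.stateSign T :=
    G.prod_comp fun i => if T i then (-1 : ℤ) else 1
  rw [h1, h2, hcirc]

theorem stateSign_update {n : ℕ} (T : Fin n → Bool) (v : Fin n) :
    BandDiagram.stateSign (Function.update T v (!T v)) = -BandDiagram.stateSign T := by
  simp only [BandDiagram.stateSign]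
  rw [← Finset.mul_prod_erase _ _ (Finset.mem_univ v),
    ← Finset.mul_prod_erase Finset.univ (fun i => if T i then (-1 : ℤ) else 1)
      (Finset.mem_univ v), ← neg_mul]
  congr 1
  · cases h : T v <;> simp
  · exact Finset.prod_congr rfl fun i hi => by
      rw [Function.update_of_ne (Finset.ne_of_mem_erase hi)]

/-- The states with an untwisted band at the chord of `p` and `q` cancel one by one, and those
with a half-twisted band in pairs that differ in the type of band at the chord of `x`. -/
theorem IsFourTerm.stateTransform_eq {n : ℕ} {M : Type*} [AddCommGroup M] (φ : ℕ → M)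
    {D₁ D₂ D₃ D₄ : ChordDiagram n} (h : IsFourTerm D₁ D₂ D₃ D₄) :
    stateTransform φ D₁ - stateTransform φ D₂ + stateTransform φ D₃ - stateTransform φ D₄ = 0 := by
  obtain ⟨s, x, p, q, hs, hpq, hc, hx, h1, h2, h3, h4⟩ := h
  simp only [stateTransform, ← Finset.sum_sub_distrib, ← Finset.sum_add_distrib]
  have hT : ∀ T : Fin n → Bool, T p.1 = false →
      BandDiagram.stateSign T • φ (D₁.toBand.stateCircles T) -
      BandDiagram.stateSign T • φ (D₂.toBand.stateCircles T) +
      BandDiagram.stateSign T • φ (D₃.toBand.stateCircles T) -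
      BandDiagram.stateSign T • φ (D₄.toBand.stateCircles T) = 0 := by
    intro T hT
    rw [stateCircles_slide_of_untwisted hs hpq hc hx h1 h4 hT,
      stateCircles_slide_of_untwisted hs hpq.symm hc.symm (hc ▸ hx) h3 h2 (hc ▸ hT)]
    abel
  have hu : ∀ T : Fin n → Bool, Function.update T x.1 (!T x.1) p.1 = T p.1 := fun T =>
    Function.update_of_ne hx _ _
  have huu : ∀ T : Fin n → Bool, Function.update (Function.update T x.1 (!T x.1)) x.1
      (!Function.update T x.1 (!T x.1) x.1) = T := fun T => by simp
  refine Finset.sum_involution (fun T _ => Function.update T x.1 (!T x.1)) ?_ ?_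
    (fun _ _ => Finset.mem_univ _) (fun T _ => huu T)
  · intro T _
    cases hTp : T p.1
    · rw [hT T hTp, hT _ ((hu T).trans hTp), add_zero]
    · have hTp' := (hu T).trans hTp
      have e1 := stateCircles_slide_before_of_twisted hs hpq hc hx h1 h3 hTp
      have e2 := stateCircles_slide_after_of_twisted hs hpq hc hx h2 h4 hTp
      have e3 := stateCircles_slide_before_of_twisted hs hpq hc hx h1 h3 hTp'
      have e4 := stateCircles_slide_after_of_twisted hs hpq hc hx h2 h4 hTp'
      rw [huu] at e3 e4
      rw [e1, e2, e3, e4, stateSign_update]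
      simp only [neg_smul]
      abel
  · intro T _ _ hc'
    have := congrFun hc' x.1
    simp at this

theorem relations_le_ker {n : ℕ} {M : Type*} [AddCommGroup M] (φ : ℕ → M) :
    relations n ≤ LinearMap.ker (Finsupp.linearCombination ℤ (stateTransform (n := n) φ)) := by
  refine Submodule.span_le.2 ?_
  rintro r (⟨D, D', h, rfl⟩ | ⟨D₁, D₂, D₃, D₄, h, rfl⟩)
  · simp [h.stateTransform_eq φ]
  · simpa using h.stateTransform_eq φ

end ChordDiagram

/-- The linear map on the group of chord diagrams that `ChordDiagram.stateTransform` induces. -/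
noncomputable def ChordSpace.stateTransform {n : ℕ} {M : Type*} [AddCommGroup M] (φ : ℕ → M) :
    ChordSpace n →ₗ[ℤ] M :=
  (ChordDiagram.relations n).liftQ _ (ChordDiagram.relations_le_ker φ)

theorem ChordSpace.stateTransform_mk {n : ℕ} {M : Type*} [AddCommGroup M] (φ : ℕ → M)
    (D : ChordDiagram n) :
    ChordSpace.stateTransform φ (ChordSpace.mk D) = D.stateTransform φ := by
  simp [ChordSpace.stateTransform, ChordSpace.mk]

namespace ChordDiagram

theorem stateSum_toBand {n : ℕ} (D : ChordDiagram n) :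
    BandDiagram.stateSum n D.toBand =
      D.stateTransform fun c => varA ^ n * varB ^ (c - 1) := by
  rw [BandDiagram.stateSum, stateTransform, Finset.mul_sum]
  refine Finset.sum_congr rfl fun T _ => ?_
  rw [zsmul_eq_mul]
  ring

theorem graphS_intersectionGraph {n : ℕ} (D : ChordDiagram n) :
    graphS D.intersectionGraph =
      D.stateTransform fun c => (Polynomial.X : Polynomial ℤ) ^ (n + 1 - c) := by
  let E : (Fin n → Bool) ≃ Finset (Fin n) :=
    { toFun := twisted
      invFun := fun J v => decide (v ∈ J)
      left_inv := fun T => by simp [twisted]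
      right_inv := fun J => by simp [twisted] }
  rw [graphS, ← E.sum_comp]
  refine Finset.sum_congr rfl fun T _ => ?_
  have h1 : (markedAdjMatrix D.intersectionGraph (E T)).rank =
      n + 1 - D.toBand.stateCircles T := by
    have := D.stateCircles_toBand T
    change (markedAdjMatrix D.intersectionGraph (twisted T)).rank = _
    omega
  have h2 : BandDiagram.stateSign T = (-1) ^ (E T).card := by
    change _ = (-1) ^ (twisted T).card
    simp [BandDiagram.stateSign, twisted, Finset.prod_ite]
  rw [h1, h2, zsmul_eq_mul]
  simp

/-- The exponents `c - 1` and `n + 1 - c` of the two state sums add up to `n`. -/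
theorem toFrac_stateTransform {n : ℕ} (D : ChordDiagram n) :
    toFrac (D.stateTransform fun c => varA ^ n * varB ^ (c - 1)) =
      (toFrac varA * toFrac varB) ^ n * Polynomial.aeval (toFrac varB)⁻¹
        (D.stateTransform fun c => (Polynomial.X : Polynomial ℤ) ^ (n + 1 - c)) := by
  have hb : toFrac varB ≠ 0 := by
    rw [toFrac, Ne, FaithfulSMul.algebraMap_eq_zero_iff]
    exact MvPolynomial.X_ne_zero 1
  rw [stateTransform, stateTransform, map_sum, map_sum, Finset.mul_sum]
  refine Finset.sum_congr rfl fun T _ => ?_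
  have h1 := D.stateCircles_toBand T
  have h2 := D.toBand.stateCircles_pos T
  generalize D.toBand.stateCircles T = c at *
  have h4 : toFrac varB ^ n * (toFrac varB)⁻¹ ^ (n + 1 - c) = toFrac varB ^ (c - 1) := by
    have h3 : toFrac varB ^ n = toFrac varB ^ (c - 1) * toFrac varB ^ (n + 1 - c) := by
      rw [← pow_add]
      congr 1
      omega
    rw [h3, mul_assoc, ← mul_pow, mul_inv_cancel₀ hb, one_pow, mul_one]
  rw [map_zsmul, map_zsmul, map_mul, map_pow, map_pow, map_pow, Polynomial.aeval_X, ← h4, mul_pow,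
    zsmul_eq_mul, zsmul_eq_mul]
  ring

end ChordDiagram

theorem theoremT :
    (∃! K : (n : ℕ) → BandDiagram n → ZAB, IsKauffmanWeight K) ∧
    ∀ K : (n : ℕ) → BandDiagram n → ZAB, IsKauffmanWeight K →
      ∀ k : ℕ,
        (∀ D : ChordDiagram k,
          toFrac (K k D.toBand) =
            (toFrac varA * toFrac varB) ^ k *
              Polynomial.aeval (toFrac varB)⁻¹ (graphS D.intersectionGraph)) ∧
        ∃ (KA : ChordSpace k →ₗ[ℤ] ZAB) (SA : ChordSpace k →ₗ[ℤ] Polynomial ℤ),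
          (∀ D : ChordDiagram k, KA (ChordSpace.mk D) = K k D.toBand) ∧
          (∀ D : ChordDiagram k, SA (ChordSpace.mk D) = graphS D.intersectionGraph) ∧
          ∀ D : ChordSpace k,
            toFrac (KA D) =
              (toFrac varA * toFrac varB) ^ k *
                Polynomial.aeval (toFrac varB)⁻¹ (SA D) := by
  refine ⟨⟨BandDiagram.stateSum, BandDiagram.isKauffmanWeight_stateSum,
    fun K hK => hK.eq_stateSum⟩, ?_⟩
  rintro K hK k
  obtain rfl := hK.eq_stateSum
  refine ⟨fun D => ?_, ChordSpace.stateTransform fun c => varA ^ k * varB ^ (c - 1),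
    ChordSpace.stateTransform fun c => (Polynomial.X : Polynomial ℤ) ^ (k + 1 - c),
    fun D => ?_, fun D => ?_, fun D => ?_⟩
  · rw [D.stateSum_toBand, D.graphS_intersectionGraph, D.toFrac_stateTransform]
  · rw [ChordSpace.stateTransform_mk, D.stateSum_toBand]
  · rw [ChordSpace.stateTransform_mk, D.graphS_intersectionGraph]
  · obtain ⟨D, rfl⟩ := Submodule.mkQ_surjective _ D
    induction D using Finsupp.induction_linear with
    | zero => simp
    | add D D' h h' => simp only [map_add, h, h', mul_add]
    | single D m =>
      have h : (ChordDiagram.relations k).mkQ (Finsupp.single D m) = m • ChordSpace.mk D := by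
        rw [ChordSpace.mk, ← map_zsmul, Finsupp.smul_single, smul_eq_mul, mul_one]
      simp only [h, map_zsmul, ChordSpace.stateTransform_mk, D.toFrac_stateTransform, mul_smul_comm]
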